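/- **Setting.** Let $N=\{1,\dots,n\}$ be a set of agents, $v:2^N\to\mathbb{R}_{\ge 0}$ a monotone submodular function with $v(\emptyset)=0$, $B>0$ a budget, and let agent $i$ have cost $c_i\in(0,B]$. Write $v(i)=v(\{i\})$ and $v(i\mid S)=v(S\cup\{i\})-v(S)$. Let $S^*$ be an optimal solution of $\max\{v(S): S\subseteq N,\ \sum_{i\in S}c_i\le B\}$, and let $\omega=(1-\varepsilon)\,v(S^*)$ with $\varepsilon\in[0,1)$ be a prediction. The agents arrive in a uniformly random order $\pi$. **Mechanism.** The parameters are $q\in[0,1]$, $k\ge 1$, $a,\beta\ge 0$. * With probability $q$ (Dynkin's algorithm): observe the first $\lfloor n/e\rfloor$ agents and let $i^*$ be the most valuable among them; from the remaining agents, hire the first agent $j$ that is at least as valuable as $i^*$, i.e. $v(j)\ge v(i^*)$, and pay her $B$. In all these comparisons, ties between agents of equal value are broken by a fixed ranking of the agents. (If no agent is observed, the first agent is hired; if no $j$ qualifies, nobody is hired.) * With probability $1-q$: draw $\xi_1\sim\mathcal{B}(n,\frac1k)$ independently of $\pi$, and let $N_1$ be the set of the first $\xi_1$ agents that arrive. Let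 $T_1\subseteq N_1$ be a $(1-\frac1e)$-approximate solution, computed by a fixed offline algorithm, of the problem of maximizing $v(S)$ over $S\subseteq N_1$ with $\sum_{i\in S}c_i\le B$ (so $T_1$ is feasible). Set $t=a\,\omega+\beta\, v(T_1)$, $S=\emptyset$, $B'=B$. For each agent $i\in N\setminus N_1$, in order of arrival: put $\bar p_i=\frac{B}{t}v(i\mid S)$; if $c_i\le\bar p_i$ and $B'-\bar p_i\ge0$, add $i$ to $S$, pay her $\bar p_i$ and decrease $B'$ by $\bar p_i$. (If $t=0$, nobody is hired.) **Theorem.** Let $z>0$ and $\delta>0$, and put $$A=a(1-\varepsilon)+\beta\cdot\tfrac{e-1}{e}\cdot\left(\tfrac1k-\delta\right),\qquad \tilde p=1-2\exp\left(-\frac{\delta^2/2}{\left(\frac{k-1}{k^2}+\frac{\delta}{3}\right)\cdot\frac1z\cdot A}\right),$$ $$m=\min\left(\tfrac{k-1}{k}-\delta-\big(a(1-\varepsilon)+\beta\big),\ \tfrac{z-1}{z}\cdot A\right).$$ Assume that $\tilde p$ and $m$ are not both negative (if $A=0$, read the fraction in $\tilde p$ as $0$; the bound is then $\le 0$). Then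 the set $S$ of agents hired by the mechanism satisfies $$\mathbb{E}[v(S)]\ \ge\ \min\left\{\frac{q}{e\,z}\cdot A,\ (1-q)\cdot\tilde p\cdot m\right\}\cdot v(S^*),$$ where the expectation is over the arrival order and the random choices of the mechanism. -/

import Mathlib

open scoped BigOperators

noncomputable section

namespace BudgetFeasible

/-- The marginal value `v(i | S) = v(S ∪ {i}) - v(S)`. -/
def marginal {n : ℕ} (v : Finset (Fin n) → ℝ) (i : Fin n) (S : Finset (Fin n)) : ℝ :=
  v (insert i S) - v S

/-- Submodularity: decreasing marginal values. -/
def IsSubmodular {n : ℕ} (v : Finset (Fin n) → ℝ) : Prop :=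
  ∀ S T : Finset (Fin n), S ⊆ T → ∀ i, i ∉ T → marginal v i T ≤ marginal v i S

/-- A set of agents is feasible if its total cost is within the budget. -/
def IsFeasible {n : ℕ} (c : Fin n → ℝ) (B : ℝ) (S : Finset (Fin n)) : Prop :=
  ∑ i ∈ S, c i ≤ B

/-- `S` is an optimal solution of `max v(S)` subject to `∑ i ∈ S, c i ≤ B` and `S ⊆ N`. -/
def IsOptimal {n : ℕ} (v : Finset (Fin n) → ℝ) (c : Fin n → ℝ) (B : ℝ)
    (S : Finset (Fin n)) : Prop :=
  IsFeasible c B S ∧ ∀ S' : Finset (Fin n), IsFeasible c B S' → v S' ≤ v S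

/-- `T` is an offline algorithm which, on every set `M` of agents, returns a feasible subset
of `M` whose value is at least `1 - 1/e` times the optimum over the feasible subsets of `M`. -/
def IsOfflineApprox {n : ℕ} (v : Finset (Fin n) → ℝ) (c : Fin n → ℝ) (B : ℝ)
    (T : Finset (Fin n) → Finset (Fin n)) : Prop :=
  ∀ M : Finset (Fin n), T M ⊆ M ∧ IsFeasible c B (T M) ∧
    ∀ S' : Finset (Fin n), S' ⊆ M → IsFeasible c B S' → (1 - 1 / Real.exp 1) * v S' ≤ v (T M)

/-- The hired agents together with the payments. -/
structure Outcome (n : ℕ) where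
  winners : Finset (Fin n)
  payment : Fin n → ℝ

/-- The agents in their order of arrival `π(1), …, π(n)`. -/
def arrivals {n : ℕ} (π : Equiv.Perm (Fin n)) : List (Fin n) := List.ofFn π

/-- The key by which single agents are compared: their value, ties between agents of equal
value being broken by the fixed ranking `tie` of the agents. -/
def score {n : ℕ} (v : Finset (Fin n) → ℝ) (tie : Equiv.Perm (Fin n)) (i : Fin n) :
    Lex (ℝ × Fin n) :=
  toLex (v {i}, tie i)

open Classical in
/-- Dynkin's algorithm for the arrival order `π`: the first `⌊n/e⌋` agents are only observed;
let `i*` be the most valuable among them. Then hire the first later agent who is at least as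
valuable as `i*`, and pay her `B`. If no agent is observed, every later agent qualifies; if no
later agent qualifies, nobody is hired. -/
def dynkin {n : ℕ} (v : Finset (Fin n) → ℝ) (B : ℝ) (tie : Equiv.Perm (Fin n))
    (π : Equiv.Perm (Fin n)) : Outcome n :=
  let r := ⌊(n : ℝ) / Real.exp 1⌋₊
  let best : Option (Fin n) := ((arrivals π).take r).argmax (score v tie)
  match ((arrivals π).drop r).find? (fun j => ∀ i ∈ best, score v tie i ≤ score v tie j) with
  | some j => ⟨{j}, Pi.single j B⟩
  | none => ⟨∅, 0⟩

/-- The state of the posted-price loop: the current outcome and the remaining budget. -/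
structure PostedState (n : ℕ) where
  outcome : Outcome n
  remaining : ℝ

open Classical in
/-- One round of the posted-price loop with threshold `t`: agent `i` is offered the price
`(B / t) * v(i | S)`, and is hired at that price if it covers her cost and does not exceed
the remaining budget. -/
def postedStep {n : ℕ} (v : Finset (Fin n) → ℝ) (c : Fin n → ℝ) (B t : ℝ)
    (s : PostedState n) (i : Fin n) : PostedState n :=
  let price := B / t * marginal v i s.outcome.winners
  if c i ≤ price ∧ 0 ≤ s.remaining - price then
    ⟨⟨insert i s.outcome.winners, Function.update s.outcome.payment i price⟩,
      s.remaining - price⟩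
  else s

/-- The sampling and posted-price part for the arrival order `π` and the sample size `ξ`:
`N₁` is the set of the first `ξ` agents, `t = a * ω + β * v(T₁)` with `T₁ = T N₁`, and prices
are posted to the agents outside `N₁` in their order of arrival. -/
def postedPrice {n : ℕ} (v : Finset (Fin n) → ℝ) (c : Fin n → ℝ) (B a β ω : ℝ)
    (T : Finset (Fin n) → Finset (Fin n)) (π : Equiv.Perm (Fin n)) (ξ : ℕ) : Outcome n :=
  let N₁ : Finset (Fin n) := ((arrivals π).take ξ).toFinset
  let t := a * ω + β * v (T N₁)
  (((arrivals π).drop ξ).foldl (postedStep v c B t) ⟨⟨∅, 0⟩, B⟩).outcome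

/-- The expected value `𝔼[v(S)]` of the set `S` hired by the mechanism: with probability `q` it
runs Dynkin's algorithm; with probability `1 - q` it draws `ξ` from the binomial distribution
with parameters `n` and `1/k` and runs the posted-price part with sample size `ξ`.
The arrival order `π` is uniform on all permutations and independent of the random choices of
the mechanism. -/
def expectedValue {n : ℕ} (v : Finset (Fin n) → ℝ) (c : Fin n → ℝ) (B q k a β ω : ℝ)
    (T : Finset (Fin n) → Finset (Fin n)) (tie : Equiv.Perm (Fin n)) : ℝ :=
  q * (𝔼 π : Equiv.Perm (Fin n), v (dynkin v B tie π).winners) +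
  (1 - q) * ∑ ξ ∈ Finset.range (n + 1),
    ((n.choose ξ : ℝ) * (1 / k) ^ ξ * (1 - 1 / k) ^ (n - ξ)) *
      (𝔼 π : Equiv.Perm (Fin n), v (postedPrice v c B a β ω T π ξ).winners)

/-- `a (1 - ε) + β ((e - 1)/e) (1/k - δ)`. -/
def thresholdFactor (k a β δ ε : ℝ) : ℝ :=
  a * (1 - ε) + β * ((Real.exp 1 - 1) / Real.exp 1) * (1 / k - δ)

/-- The probability bound `p̃`. -/
def pTilde (k z a β δ ε : ℝ) : ℝ :=
  1 - 2 * Real.exp (-((δ ^ 2 / 2) /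
    (((k - 1) / k ^ 2 + δ / 3) * (1 / z) * thresholdFactor k a β δ ε)))

/-- The smaller of the two bounds for the posted-price part. -/
def caseBound (k z a β δ ε : ℝ) : ℝ :=
  min ((k - 1) / k - δ - (a * (1 - ε) + β)) ((z - 1) / z * thresholdFactor k a β δ ε)

/-- The approximation guarantee of the mechanism. -/
def guarantee (q k z a β δ ε : ℝ) : ℝ :=
  min (q / (Real.exp 1 * z) * thresholdFactor k a β δ ε)
    ((1 - q) * pTilde k z a β δ ε * caseBound k z a β δ ε)

end BudgetFeasible

end

/-! The proof splits on whether one agent is worth more than `A * v(S*) / z`, with `A` the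
`thresholdFactor`. If so, Dynkin's algorithm hires the best agent with probability at least `1/e`
(`inv_exp_mul_le_expect_dynkin`), and the branch of weight `q` alone pays for the first term of the
minimum.

Otherwise the value of `S*` is spread over many agents. A binomial prefix of a uniform order
contains each agent independently with probability `1/k` (`sum_binomial_expect_take`). An additive
minorant `w` of `v` with total weight `v(S*)` (`exists_additive_minorant`) turns the sampled share
of `S*` into a sum of small independent terms, so Bernstein's inequality keeps it within `δ * v(S*)`
of its mean with probability at least `p̃`. On that event `A * v(S*) ≤ t ≤ (a(1-ε)+β) * v(S*)`, and
`S* \ N₁` is still worth `(1-1/k-δ) * v(S*)`.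

The posted prices then leave two outcomes (`posted_foldl_dichotomy`). Either some agent fails only
for lack of budget, and `v(S)` is within one singleton value of `t`; or every missed agent has
marginal value at most `t * c i / B`, and missing `S* \ N₁` costs at most `t` in total. These give
the two terms of `m`. -/

namespace BudgetFeasible

/-! ### Monotone submodular functions. -/

variable {n : ℕ} {v : Finset (Fin n) → ℝ}

theorem nonneg_of_monotone (hv0 : v ∅ = 0) (hvmono : Monotone v) (S : Finset (Fin n)) :
    0 ≤ v S := hv0 ▸ hvmono (Finset.empty_subset S)

theorem marginal_nonneg (hvmono : Monotone v) (i : Fin n) (S : Finset (Fin n)) :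
    0 ≤ marginal v i S :=
  sub_nonneg.2 (hvmono (Finset.subset_insert i S))

theorem marginal_le_singleton (hv0 : v ∅ = 0) (hvmono : Monotone v) (hvsub : IsSubmodular v)
    (i : Fin n) (S : Finset (Fin n)) : marginal v i S ≤ v {i} := by
  by_cases hi : i ∈ S
  · simpa [marginal, Finset.insert_eq_of_mem hi] using nonneg_of_monotone hv0 hvmono {i}
  · simpa [marginal, hv0] using hvsub ∅ S (Finset.empty_subset S) i hi

/-- A monotone submodular function is bounded below, on the subsets of a given set `s`, by an
additive function which agrees with it on `s`. -/
theorem exists_additive_minorant (hv0 : v ∅ = 0) (hvmono : Monotone v) (hvsub : IsSubmodular v)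
    (s : Finset (Fin n)) :
    ∃ w : Fin n → ℝ, (∀ i, 0 ≤ w i ∧ w i ≤ v {i}) ∧ (∀ i, i ∉ s → w i = 0) ∧
      ∑ i, w i = v s ∧ ∀ R : Finset (Fin n), ∑ i ∈ R, w i ≤ v (s ∩ R) := by
  induction s using Finset.induction_on with
  | empty =>
    exact ⟨0, fun i => ⟨le_rfl, nonneg_of_monotone hv0 hvmono _⟩, by simp, by simp [hv0],
      by simp [hv0]⟩
  | insert a s ha ih =>
    obtain ⟨w, hw, hws, hsum, hR⟩ := ih
    -- The weights are the marginal values along a chain building up `s`. They telescope to `v s`;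
    -- on `s ∩ R` each element is added to a smaller set, so its marginal value there can only be
    -- larger.
    refine ⟨Function.update w a (marginal v a s), fun i => ?_, fun i hi => ?_, ?_, fun R => ?_⟩
    · rcases eq_or_ne i a with rfl | h
      · simpa using ⟨marginal_nonneg hvmono i s, marginal_le_singleton hv0 hvmono hvsub i s⟩
      · simpa [h] using hw i
    · simp only [Finset.mem_insert, not_or] at hi
      simp [hi.1, hws i hi.2]
    · rw [Finset.sum_update_of_mem (Finset.mem_univ a)]
      have := Finset.sum_sdiff (Finset.subset_univ {a}) (f := w)
      rw [Finset.sum_singleton, hws a ha, hsum, add_zero] at this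
      rw [this, marginal, sub_add_cancel]
    · by_cases haR : a ∈ R
      · rw [Finset.sum_update_of_mem haR, Finset.insert_inter_of_mem haR]
        have h1 := hR (R \ {a})
        have h2 : s ∩ (R \ {a}) = s ∩ R := by
          ext i
          simp only [Finset.mem_inter, Finset.mem_sdiff, Finset.mem_singleton]
          exact ⟨fun h => ⟨h.1, h.2.1⟩, fun h => ⟨h.1, h.2, fun e => ha (e ▸ h.1)⟩⟩
        have h3 := hvsub (s ∩ R) s Finset.inter_subset_left a ha
        rw [h2] at h1
        simp only [marginal] at h3 ⊢
        linarith
      · rw [Finset.sum_update_of_notMem haR, Finset.insert_inter_of_notMem haR]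
        exact hR R

/-- The value of `U` exceeds that of `S` by at most the sum of the marginal values over `S` of
the elements of `U`. -/
theorem le_add_sum_marginal (hvmono : Monotone v) (hvsub : IsSubmodular v)
    (S U : Finset (Fin n)) : v U ≤ v S + ∑ i ∈ U \ S, marginal v i S := by
  suffices h : ∀ R : Finset (Fin n), Disjoint R S → v (S ∪ R) ≤ v S + ∑ i ∈ R, marginal v i S by
    refine le_trans (hvmono ?_) (h (U \ S) Finset.sdiff_disjoint)
    rw [Finset.union_sdiff_self_eq_union]
    exact Finset.subset_union_right
  intro R
  induction R using Finset.induction_on with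
  | empty => simp
  | insert a R ha ih =>
    intro hd
    rw [Finset.disjoint_insert_left] at hd
    have h1 := hvsub S (S ∪ R) Finset.subset_union_left a (by simp [ha, hd.1])
    have h2 := ih hd.2
    rw [Finset.sum_insert ha, Finset.union_insert]
    simp only [marginal] at *
    linarith

/-! ### The posted-price loop for a fixed threshold. -/

section PostedPrice

variable {c : Fin n → ℝ} {B t : ℝ}

theorem winners_subset_foldl (l : List (Fin n)) (s : PostedState n) :
    s.outcome.winners ⊆ (l.foldl (postedStep v c B t) s).outcome.winners := by
  induction l generalizing s with
  | nil => exact subset_rfl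
  | cons i l ih =>
    rw [List.foldl_cons]
    refine subset_trans ?_ (ih _)
    unfold postedStep
    dsimp only
    split_ifs
    · exact Finset.subset_insert _ _
    · exact subset_rfl

/-- Either the posted-price loop runs out of budget, and then the value of the winners is close
to the threshold, or every agent who is not hired has a small marginal value. -/
theorem posted_foldl_dichotomy (hvmono : Monotone v) (hvsub : IsSubmodular v)
    (hB : 0 < B) (ht : 0 < t) {M : ℝ} (hM : ∀ i S, marginal v i S ≤ M)
    (l : List (Fin n)) (s : PostedState n) (hs : s.remaining = B - B / t * v s.outcome.winners) :
    t - M ≤ v (l.foldl (postedStep v c B t) s).outcome.winners ∨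
    ∀ i ∈ l, i ∉ (l.foldl (postedStep v c B t) s).outcome.winners →
      marginal v i (l.foldl (postedStep v c B t) s).outcome.winners ≤ t / B * c i := by
  induction l generalizing s with
  | nil => exact Or.inr (by simp)
  | cons i l ih =>
    rw [List.foldl_cons]
    have hsub := winners_subset_foldl (v := v) (c := c) (B := B) (t := t) l
      (postedStep v c B t s i)
    have hBt : 0 < B / t := div_pos hB ht
    by_cases h : c i ≤ B / t * marginal v i s.outcome.winners ∧
        0 ≤ s.remaining - B / t * marginal v i s.outcome.winners
    · have hstep : postedStep v c B t s i = ⟨⟨insert i s.outcome.winners,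
          Function.update s.outcome.payment i (B / t * marginal v i s.outcome.winners)⟩,
          s.remaining - B / t * marginal v i s.outcome.winners⟩ := by
        unfold postedStep
        exact if_pos h
      -- Prices are marginal values scaled by `B / t`, so payments telescope and the invariant `hs`
      -- survives a hire.
      rcases ih (postedStep v c B t s i) (by rw [hstep]; simp only [hs, marginal]; ring)
        with h1 | h1
      · exact Or.inl h1
      · refine Or.inr fun j hj hjn => ?_
        rcases List.mem_cons.1 hj with rfl | hj
        · exact absurd (hsub (by rw [hstep]; simp)) hjn
        · exact h1 j hj hjn
    · have hstep : postedStep v c B t s i = s := by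
        unfold postedStep
        exact if_neg h
      rw [hstep] at hsub ⊢
      rcases ih s hs with h1 | h1
      · exact Or.inl h1
      · by_cases hci : c i ≤ B / t * marginal v i s.outcome.winners
        -- The budget is the obstacle: the price exceeds `B - B / t * v S`, so one more agent would
        -- have lifted the value above `t`.
        · left
          have h2 : s.remaining - B / t * marginal v i s.outcome.winners < 0 := by
            by_contra hcon
            exact h ⟨hci, not_lt.1 hcon⟩
          have h3 := hM i s.outcome.winners
          have h4 := hvmono hsub
          have h5 : B / t * t = B := div_mul_cancel₀ B ht.ne'
          have h6 : B / t * (t - v s.outcome.winners - marginal v i s.outcome.winners) < 0 := by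
            rw [hs] at h2
            linarith
          have h7 := neg_of_mul_neg_right h6 hBt.le
          have h8 : v s.outcome.winners ≤
            v (List.foldl (postedStep v c B t) s l).outcome.winners := h4
          linarith
        · refine Or.inr fun j hj hjn => ?_
          rcases List.mem_cons.1 hj with rfl | hj
          -- The agent refused the price at rejection time; by submodularity her marginal value over
          -- the final set is no larger.
          · refine (hvsub _ _ hsub j hjn).trans ?_
            have h2 := (not_le.1 hci).le
            calc marginal v j s.outcome.winners
                = t / B * (B / t * marginal v j s.outcome.winners) := by field_simp
              _ ≤ t / B * c j := mul_le_mul_of_nonneg_left h2 (div_pos ht hB).le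
          · exact h1 j hj hjn

/-- In the second case of the dichotomy the missed agents of `U` have marginal values summing to at
most `t / B` times the cost of `U`, hence to at most `t`. -/
theorem foldl_posted_lower_bound (hv0 : v ∅ = 0) (hvmono : Monotone v) (hvsub : IsSubmodular v)
    (hB : 0 < B) (ht : 0 < t) (hc : ∀ i, 0 < c i) {M : ℝ} (hM : ∀ i, v {i} ≤ M)
    {U : Finset (Fin n)} (hU : IsFeasible c B U) (l : List (Fin n)) (hl : ∀ i ∈ U, i ∈ l)
    {s : PostedState n} (hs0 : s.outcome.winners = ∅) (hs : s.remaining = B) :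
    min (v U - t) (t - M) ≤ v (l.foldl (postedStep v c B t) s).outcome.winners := by
  rcases posted_foldl_dichotomy (c := c) hvmono hvsub hB ht
    (fun i S => (marginal_le_singleton hv0 hvmono hvsub i S).trans (hM i)) l s
    (by rw [hs, hs0, hv0]; ring) with h | h
  · exact (min_le_right _ _).trans h
  · refine (min_le_left _ _).trans ?_
    have h1 := le_add_sum_marginal hvmono hvsub
      (l.foldl (postedStep v c B t) s).outcome.winners U
    have h2 : ∑ i ∈ U \ (l.foldl (postedStep v c B t) s).outcome.winners,
        marginal v i (l.foldl (postedStep v c B t) s).outcome.winners ≤ t := by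
      calc _ ≤ ∑ i ∈ U \ (l.foldl (postedStep v c B t) s).outcome.winners, t / B * c i :=
            Finset.sum_le_sum fun i hi =>
              h i (hl i (Finset.mem_sdiff.1 hi).1) (Finset.mem_sdiff.1 hi).2
        _ ≤ ∑ i ∈ U, t / B * c i :=
            Finset.sum_le_sum_of_subset_of_nonneg Finset.sdiff_subset
              fun i _ _ => (mul_pos (div_pos ht hB) (hc i)).le
        _ = t / B * ∑ i ∈ U, c i := (Finset.mul_sum _ _ _).symm
        _ ≤ t / B * B := mul_le_mul_of_nonneg_left hU (div_pos ht hB).le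
        _ = t := div_mul_cancel₀ t hB.ne'
    linarith

end PostedPrice

/-! ### Binomial prefixes as Bernoulli samples, and their concentration. -/

section RandomSubset

theorem exists_perm_map_eq {s s' : Finset (Fin n)} (h : s.card = s'.card) :
    ∃ σ : Equiv.Perm (Fin n), s.map σ.toEmbedding = s' := by
  let e : {x // x ∈ s} ≃ {x // x ∈ s'} := Finset.equivOfCardEq h
  refine ⟨e.extendSubtype, Finset.eq_of_subset_of_card_le (fun y hy => ?_) (by simp [h])⟩
  obtain ⟨x, hx, rfl⟩ := Finset.mem_map.1 hy
  exact e.extendSubtype_mem x hx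

/-- The image of a fixed set under a uniformly random permutation is uniformly distributed among
the sets of the same size. -/
theorem expect_perm_map (s : Finset (Fin n)) (g : Finset (Fin n) → ℝ) :
    𝔼 π : Equiv.Perm (Fin n), g (s.map π.toEmbedding) =
      𝔼 S ∈ Finset.powersetCard s.card Finset.univ, g S := by
  have hne : (Finset.powersetCard s.card (Finset.univ : Finset (Fin n))).Nonempty :=
    ⟨s, by simp⟩
  have h1 : ∀ s' ∈ Finset.powersetCard s.card (Finset.univ : Finset (Fin n)),
      𝔼 π : Equiv.Perm (Fin n), g (s'.map π.toEmbedding) =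
        𝔼 π : Equiv.Perm (Fin n), g (s.map π.toEmbedding) := by
    intro s' hs'
    obtain ⟨σ, hσ⟩ := exists_perm_map_eq (Finset.mem_powersetCard.1 hs').2.symm
    refine Fintype.expect_equiv (Equiv.mulRight σ) _ _ fun π => ?_
    rw [← hσ, Finset.map_map]
    rfl
  have h2 : ∀ π ∈ (Finset.univ : Finset (Equiv.Perm (Fin n))),
      𝔼 S ∈ Finset.powersetCard s.card Finset.univ, g (S.map π.toEmbedding) =
        𝔼 S ∈ Finset.powersetCard s.card Finset.univ, g S := by
    intro π _
    exact Finset.expect_equiv π.finsetCongr (fun S => by simp) (fun S _ => rfl)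
  -- Double averaging: the left side is the same for every `s'` of this size, the right side for
  -- every `π`, so both equal the average over pairs.
  rw [← Finset.expect_const hne (𝔼 π : Equiv.Perm (Fin n), g (s.map π.toEmbedding)),
    ← Finset.expect_congr rfl h1, Finset.expect_comm, Finset.expect_congr rfl h2,
    Finset.expect_const Finset.univ_nonempty]

theorem toFinset_take_arrivals (π : Equiv.Perm (Fin n)) (ξ : ℕ) :
    ((arrivals π).take ξ).toFinset =
      (Finset.univ.filter fun i : Fin n => i.val < ξ).map π.toEmbedding := by
  ext x
  simp only [arrivals, List.mem_toFinset, List.mem_take_iff_getElem, List.getElem_ofFn,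
    List.length_ofFn, Finset.mem_map, Finset.mem_filter, Finset.mem_univ, true_and]
  constructor
  · rintro ⟨i, hi, rfl⟩
    exact ⟨⟨i, by omega⟩, by simp; omega, rfl⟩
  · rintro ⟨i, hi, rfl⟩
    exact ⟨i, by omega, rfl⟩

/-- If the size of the sample is binomial, then the sample contains every agent independently
with the same probability. -/
theorem sum_binomial_expect_take (p : ℝ) (g : Finset (Fin n) → ℝ) :
    ∑ ξ ∈ Finset.range (n + 1), ((n.choose ξ : ℝ) * p ^ ξ * (1 - p) ^ (n - ξ)) *
      (𝔼 π : Equiv.Perm (Fin n), g ((arrivals π).take ξ).toFinset) =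
    ∑ S : Finset (Fin n), p ^ S.card * (1 - p) ^ (n - S.card) * g S := by
  rw [← Finset.powerset_univ, Finset.sum_powerset, Finset.card_univ, Fintype.card_fin]
  refine Finset.sum_congr rfl fun ξ hξ => ?_
  have hξn : ξ ≤ n := Nat.lt_succ_iff.1 (Finset.mem_range.1 hξ)
  have hcard : (Finset.univ.filter fun i : Fin n => i.val < ξ).card = ξ := by
    rw [Fin.card_filter_val_lt, min_eq_right hξn]
  simp only [toFinset_take_arrivals]
  rw [expect_perm_map, hcard, Finset.expect_eq_sum_div_card, Finset.card_powersetCard,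
    Finset.card_univ, Fintype.card_fin]
  have hpos : (n.choose ξ : ℝ) ≠ 0 := by
    exact_mod_cast (Nat.choose_pos hξn).ne'
  calc (n.choose ξ : ℝ) * p ^ ξ * (1 - p) ^ (n - ξ) *
        ((∑ S ∈ Finset.powersetCard ξ Finset.univ, g S) / n.choose ξ)
      = p ^ ξ * (1 - p) ^ (n - ξ) * ∑ S ∈ Finset.powersetCard ξ Finset.univ, g S := by field_simp
    _ = ∑ S ∈ Finset.powersetCard ξ Finset.univ,
          p ^ S.card * (1 - p) ^ (n - S.card) * g S := by
        rw [Finset.mul_sum]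
        refine Finset.sum_congr rfl fun S hS => ?_
        rw [(Finset.mem_powersetCard.1 hS).2]

/-- The weight of a set in the product Bernoulli distribution with parameter `p`. -/
def bernoulliWeight (p : ℝ) (S : Finset (Fin n)) : ℝ := p ^ S.card * (1 - p) ^ (n - S.card)

theorem bernoulliWeight_nonneg {p : ℝ} (hp0 : 0 ≤ p) (hp1 : p ≤ 1) (S : Finset (Fin n)) :
    0 ≤ bernoulliWeight p S :=
  mul_nonneg (pow_nonneg hp0 _) (pow_nonneg (sub_nonneg.2 hp1) _)

/-- Independence of the inclusions: expanding the product chooses, for each agent, in or out. -/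
theorem sum_bernoulliWeight_mul_exp (p : ℝ) (x : Fin n → ℝ) :
    ∑ S : Finset (Fin n), bernoulliWeight p S * Real.exp (∑ i ∈ S, x i) =
      ∏ i, (p * Real.exp (x i) + (1 - p)) := by
  rw [Fintype.prod_add]
  refine Finset.sum_congr rfl fun S _ => ?_
  rw [Finset.prod_mul_distrib, Finset.prod_const, Finset.prod_const, Finset.card_compl,
    Fintype.card_fin, Real.exp_sum, bernoulliWeight]
  ring

theorem sum_bernoulliWeight (p : ℝ) : ∑ S : Finset (Fin n), bernoulliWeight p S = 1 := by
  simpa using sum_bernoulliWeight_mul_exp (n := n) p 0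

/-- Since `(j + 2)! ≥ 2 * 3 ^ j`, the exponential series from the quadratic term on is dominated by
a geometric series of ratio `b / 3`. -/
theorem exp_le_one_add_add_sq_div {x b : ℝ} (hx : |x| ≤ b) (hb : b < 3) :
    Real.exp x ≤ 1 + x + x ^ 2 / (2 * (1 - b / 3)) := by
  have hb0 : 0 ≤ b := (abs_nonneg x).trans hx
  have h1 : HasSum (fun j : ℕ => x ^ j / (j.factorial : ℝ)) (Real.exp x) := by
    rw [Real.exp_eq_exp_ℝ]
    exact NormedSpace.expSeries_div_hasSum_exp x
  have h2 := (hasSum_nat_add_iff' 2).2 h1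
  have h3 := (hasSum_geometric_of_lt_one (r := b / 3) (by positivity) (by linarith)).mul_left
    (x ^ 2 / 2)
  have h4 : ∀ j : ℕ, x ^ (j + 2) / ((j + 2).factorial : ℝ) ≤ x ^ 2 / 2 * (b / 3) ^ j := by
    intro j
    have hfac : (2 * 3 ^ j : ℝ) ≤ ((j + 2).factorial : ℝ) := by
      have := Nat.factorial_mul_pow_le_factorial (m := 2) (n := j)
      rw [add_comm j 2]
      exact_mod_cast this
    have hxj : x ^ j ≤ b ^ j :=
      (le_abs_self _).trans ((abs_pow x j).le.trans (pow_le_pow_left₀ (abs_nonneg x) hx j))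
    calc x ^ (j + 2) / ((j + 2).factorial : ℝ) = x ^ 2 * x ^ j / ((j + 2).factorial : ℝ) := by
          rw [pow_add, mul_comm]
      _ ≤ x ^ 2 * b ^ j / ((j + 2).factorial : ℝ) := by gcongr
      _ ≤ x ^ 2 * b ^ j / (2 * 3 ^ j) := by gcongr
      _ = x ^ 2 / 2 * (b / 3) ^ j := by rw [div_pow]; field_simp
  have h5 := hasSum_le h4 h2 h3
  simp only [Finset.sum_range_succ, Finset.sum_range_zero, Nat.factorial, pow_zero, pow_one] at h5
  have h6 : x ^ 2 / 2 * (1 - b / 3)⁻¹ = x ^ 2 / (2 * (1 - b / 3)) := by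
    rw [← div_eq_mul_inv, div_div]
  rw [h6] at h5
  norm_num at h5
  linarith

/-- After centring, the variable takes the values `(1 - p) * u` and `-p * u`: the linear terms
cancel and the quadratic ones combine to the variance `p * (1 - p) * u ^ 2`. -/
theorem bernoulli_mgf_le {p u b : ℝ} (hp0 : 0 ≤ p) (hp1 : p ≤ 1) (hu : |u| ≤ b) (hb : b < 3) :
    p * Real.exp u + (1 - p) ≤
      Real.exp (p * u + p * (1 - p) * u ^ 2 / (2 * (1 - b / 3))) := by
  have hq : |1 - p| ≤ 1 := abs_le.2 ⟨by linarith, by linarith⟩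
  have hp : |-p| ≤ 1 := abs_le.2 ⟨by linarith, by linarith⟩
  have h1 := exp_le_one_add_add_sq_div (x := (1 - p) * u) (b := b)
    (by rw [abs_mul]; exact (mul_le_of_le_one_left (abs_nonneg u) hq).trans hu) hb
  have h2 := exp_le_one_add_add_sq_div (x := -p * u) (b := b)
    (by rw [abs_mul]; exact (mul_le_of_le_one_left (abs_nonneg u) hp).trans hu) hb
  have h3 := mul_le_mul_of_nonneg_left h1 hp0
  have h4 := mul_le_mul_of_nonneg_left h2 (sub_nonneg.2 hp1)
  have h5 := Real.add_one_le_exp (p * (1 - p) * u ^ 2 / (2 * (1 - b / 3)))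
  have h6 : p * Real.exp u + (1 - p) =
      Real.exp (p * u) * (p * Real.exp ((1 - p) * u) + (1 - p) * Real.exp (-p * u)) := by
    rw [mul_add, mul_left_comm, mul_left_comm _ (1 - p), ← Real.exp_add, ← Real.exp_add]
    have e1 : p * u + (1 - p) * u = u := by ring
    have e2 : p * u + -p * u = 0 := by ring
    rw [e1, e2, Real.exp_zero, mul_one]
  rw [h6, Real.exp_add]
  refine mul_le_mul_of_nonneg_left ?_ (Real.exp_pos _).le
  refine le_trans (add_le_add h3 h4) (le_trans (le_of_eq ?_) h5)
  ring

/-- Bernstein's inequality for weighted sums of independent Bernoulli variables. -/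
theorem bernstein_of_pos {p M D τ : ℝ} (hp0 : 0 ≤ p) (hp1 : p ≤ 1) (hM : 0 < M) (hD : 0 < D)
    (hτ : 0 < τ) (y : Fin n → ℝ) (hy : ∀ i, |y i| ≤ M) (hvar : p * (1 - p) * ∑ i, y i ^ 2 ≤ D) :
    ∑ S : Finset (Fin n) with τ < ∑ i ∈ S, y i - p * ∑ i, y i, bernoulliWeight p S ≤
      Real.exp (-((τ ^ 2 / 2) / (D + M * τ / 3))) := by
  set E := D + M * τ / 3 with hE
  have hE0 : 0 < E := by positivity
  -- Bernstein's choice of the Chernoff parameter. It makes `1 - l * M / 3 = D / E`, and `D > 0` is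
  -- what gives `l * M < 3`.
  set l := τ / E with hl
  have hl0 : 0 < l := by positivity
  have hb : l * M < 3 := by
    rw [hl, div_mul_eq_mul_div, div_lt_iff₀ hE0, hE]
    nlinarith
  have hbD : 1 - l * M / 3 = D / E := by
    rw [hl]
    field_simp
    rw [hE]
    ring
  have hmgf : ∑ S : Finset (Fin n), bernoulliWeight p S * Real.exp (∑ i ∈ S, l * y i) ≤
      Real.exp (l * (p * ∑ i, y i) + l * τ / 2) := by
    rw [sum_bernoulliWeight_mul_exp]
    calc ∏ i, (p * Real.exp (l * y i) + (1 - p))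
        ≤ ∏ i, Real.exp (p * (l * y i) + p * (1 - p) * (l * y i) ^ 2 / (2 * (1 - l * M / 3))) := by
          refine Finset.prod_le_prod (fun i _ => ?_) fun i _ => ?_
          · exact add_nonneg (mul_nonneg hp0 (Real.exp_pos _).le) (sub_nonneg.2 hp1)
          · refine bernoulli_mgf_le hp0 hp1 ?_ hb
            rw [abs_mul, abs_of_pos hl0]
            exact mul_le_mul_of_nonneg_left (hy i) hl0.le
      _ = Real.exp (l * (p * ∑ i, y i) +
            l ^ 2 * (p * (1 - p) * ∑ i, y i ^ 2) / (2 * (1 - l * M / 3))) := by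
          rw [← Real.exp_sum, Finset.sum_add_distrib, ← Finset.sum_div, ← Finset.mul_sum,
            ← Finset.mul_sum, ← Finset.mul_sum]
          simp only [mul_pow]
          rw [← Finset.mul_sum]
          ring_nf
      _ ≤ Real.exp (l * (p * ∑ i, y i) + l * τ / 2) := by
          refine Real.exp_le_exp.2 (add_le_add_right ?_ _)
          rw [hbD]
          calc l ^ 2 * (p * (1 - p) * ∑ i, y i ^ 2) / (2 * (D / E))
              ≤ l ^ 2 * D / (2 * (D / E)) := by gcongr
            _ = l * τ / 2 := by rw [hl]; field_simp
  have hmarkov : (∑ S : Finset (Fin n) with τ < ∑ i ∈ S, y i - p * ∑ i, y i,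
      bernoulliWeight p S) * Real.exp (l * (p * ∑ i, y i) + l * τ) ≤
      ∑ S : Finset (Fin n), bernoulliWeight p S * Real.exp (∑ i ∈ S, l * y i) := by
    rw [Finset.sum_mul]
    refine (Finset.sum_le_sum fun S hS => ?_).trans
      (Finset.sum_le_sum_of_subset_of_nonneg (Finset.filter_subset _ _) fun S _ _ =>
        mul_nonneg (bernoulliWeight_nonneg hp0 hp1 S) (Real.exp_pos _).le)
    refine mul_le_mul_of_nonneg_left (Real.exp_le_exp.2 ?_) (bernoulliWeight_nonneg hp0 hp1 S)
    have h1 := (Finset.mem_filter.1 hS).2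
    rw [← Finset.mul_sum, ← mul_add]
    exact mul_le_mul_of_nonneg_left (by linarith) hl0.le
  have h1 := (le_div_iff₀ (Real.exp_pos _)).2 (hmarkov.trans hmgf)
  rw [← Real.exp_sub] at h1
  refine h1.trans (Real.exp_le_exp.2 (le_of_eq ?_))
  rw [hl]
  field_simp
  ring

/-- The case `D = 0` is needed because the variance vanishes at `p = 1`, that is `k = 1`. It follows
by letting the variance bound decrease to `D`. -/
theorem bernstein {p M D τ : ℝ} (hp0 : 0 ≤ p) (hp1 : p ≤ 1) (hM : 0 < M) (hD : 0 ≤ D)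
    (hτ : 0 < τ) (y : Fin n → ℝ) (hy : ∀ i, |y i| ≤ M) (hvar : p * (1 - p) * ∑ i, y i ^ 2 ≤ D) :
    ∑ S : Finset (Fin n) with τ < ∑ i ∈ S, y i - p * ∑ i, y i, bernoulliWeight p S ≤
      Real.exp (-((τ ^ 2 / 2) / (D + M * τ / 3))) := by
  have hpos : 0 < D + M * τ / 3 := by positivity
  have hcont : ContinuousAt (fun d : ℝ => Real.exp (-((τ ^ 2 / 2) / (d + M * τ / 3)))) D :=
    (ContinuousAt.div continuousAt_const (g := fun d => d + M * τ / 3) (by fun_prop)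
      hpos.ne').neg.rexp
  refine ge_of_tendsto (hcont.tendsto.mono_left (nhdsWithin_le_nhds (s := Set.Ioi D))) ?_
  filter_upwards [self_mem_nhdsWithin] with d hd
  exact bernstein_of_pos hp0 hp1 hM (hD.trans_lt hd) hτ y hy (hvar.trans (le_of_lt hd))

/-- The two-sided tail bound for the sum of nonnegative weights over a random set of agents. -/
theorem one_sub_two_mul_exp_le_sum_bernoulliWeight {p M V δ : ℝ} (hp0 : 0 ≤ p) (hp1 : p ≤ 1)
    (hM : 0 < M) (hV : 0 < V) (hδ : 0 < δ) (w : Fin n → ℝ) (hw0 : ∀ i, 0 ≤ w i)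
    (hwM : ∀ i, w i ≤ M * V) (hwV : ∑ i, w i = V) :
    1 - 2 * Real.exp (-((δ ^ 2 / 2) / ((p * (1 - p) + δ / 3) * M))) ≤
      ∑ S : Finset (Fin n) with (p - δ) * V ≤ ∑ i ∈ S, w i ∧ ∑ i ∈ S, w i ≤ (p + δ) * V,
        bernoulliWeight p S := by
  have hp1' : 0 ≤ 1 - p := sub_nonneg.2 hp1
  have hsq : ∑ i, w i ^ 2 ≤ M * V * V := by
    calc ∑ i, w i ^ 2 ≤ ∑ i, M * V * w i := Finset.sum_le_sum fun i _ => by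
          rw [pow_two]
          exact mul_le_mul_of_nonneg_right (hwM i) (hw0 i)
      _ = M * V * V := by rw [← Finset.mul_sum, hwV]
  have hvar := mul_le_mul_of_nonneg_left hsq (mul_nonneg hp0 hp1')
  have hD : 0 ≤ p * (1 - p) * (M * V * V) := by positivity
  have habs : ∀ i, |w i| ≤ M * V := fun i => by rw [abs_of_nonneg (hw0 i)]; exact hwM i
  have h1 := bernstein hp0 hp1 (mul_pos hM hV) hD (mul_pos hδ hV) w habs hvar
  have h2 := bernstein hp0 hp1 (mul_pos hM hV) hD (mul_pos hδ hV) (fun i => - w i)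
    (by simpa using habs) (by simpa using hvar)
  have hexp : ((δ * V) ^ 2 / 2) / (p * (1 - p) * (M * V * V) + M * V * (δ * V) / 3) =
      (δ ^ 2 / 2) / ((p * (1 - p) + δ / 3) * M) := by
    have : 0 < p * (1 - p) + δ / 3 := by positivity
    rw [show (δ * V) ^ 2 / 2 = δ ^ 2 / 2 * V ^ 2 by ring,
      show p * (1 - p) * (M * V * V) + M * V * (δ * V) / 3 =
        (p * (1 - p) + δ / 3) * M * V ^ 2 by ring]
    exact mul_div_mul_right _ _ (by positivity)
  rw [hexp] at h1 h2
  simp only [Finset.sum_neg_distrib, hwV] at h1 h2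
  rw [sub_le_iff_le_add, two_mul]
  refine le_trans ?_ (add_le_add_right (add_le_add h1 h2) _)
  refine (sum_bernoulliWeight (n := n) p).symm.le.trans ?_
  simp only [Finset.sum_filter, ← Finset.sum_add_distrib]
  refine Finset.sum_le_sum fun S _ => ?_
  have hW := bernoulliWeight_nonneg hp0 hp1 S
  -- Union bound, set by set: a set outside the window lies in the upper tail (for `w`) or the lower
  -- tail (for `-w`).
  split_ifs with c1 c2 c3 c3 c2 c3 c3 <;> try linarith
  exfalso
  refine c1 ⟨?_, ?_⟩ <;> nlinarith

end RandomSubset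

/-! ### Counting arrival orders for the secretary problem. -/

section Secretary

variable {α : Type*} [LinearOrder α]

open Classical in
/-- The arrival orders in which `b` is in position `j` and the best of the agents before her is
in position `i`. -/
def recordEvent (f : Fin n → α) (b j i : Fin n) : Finset (Equiv.Perm (Fin n)) :=
  Finset.univ.filter fun π => π j = b ∧ ∀ l < j, f (π l) ≤ f (π i)

theorem mem_recordEvent {f : Fin n → α} {b j i : Fin n} {π : Equiv.Perm (Fin n)} :
    π ∈ recordEvent f b j i ↔ π j = b ∧ ∀ l < j, f (π l) ≤ f (π i) := by
  simp [recordEvent]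

theorem card_filter_apply_eq (b j : Fin n) :
    n * (Finset.univ.filter fun π : Equiv.Perm (Fin n) => π j = b).card = n.factorial := by
  have h1 : ∀ j' ∈ (Finset.univ : Finset (Fin n)),
      (Finset.univ.filter fun π : Equiv.Perm (Fin n) => π.symm b = j').card =
        (Finset.univ.filter fun π : Equiv.Perm (Fin n) => π j = b).card := by
    intro j' _
    refine Finset.card_equiv (Equiv.mulRight (Equiv.swap j j')) fun π => ?_
    simp [Equiv.symm_apply_eq, eq_comm (a := b)]
  have h2 := Finset.card_eq_sum_card_fiberwise (s := (Finset.univ : Finset (Equiv.Perm (Fin n))))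
    (t := Finset.univ) (f := fun π => π.symm b) (fun _ _ => Finset.mem_coe.2 (Finset.mem_univ _))
  rw [Finset.sum_congr rfl h1, Finset.sum_const, Finset.card_univ, Finset.card_univ,
    Fintype.card_perm, Fintype.card_fin] at h2
  simpa using h2.symm

/-- Exchanging the agents in positions `i` and `i'` is a bijection, as it only permutes the
predecessors of `b`. -/
theorem card_recordEvent_eq (f : Fin n → α) (b : Fin n) {j i i' : Fin n} (hi : i < j)
    (hi' : i' < j) : (recordEvent f b j i).card = (recordEvent f b j i').card := by
  have key : ∀ {i i' : Fin n}, i < j → i' < j → ∀ π ∈ recordEvent f b j i,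
      π * Equiv.swap i i' ∈ recordEvent f b j i' := by
    intro i i' hi hi' π hπ
    rw [mem_recordEvent] at hπ ⊢
    refine ⟨?_, fun l hl => ?_⟩
    · rw [Equiv.Perm.mul_apply, Equiv.swap_apply_of_ne_of_ne hi.ne' hi'.ne', hπ.1]
    · rw [Equiv.Perm.mul_apply, Equiv.Perm.mul_apply, Equiv.swap_apply_right]
      refine hπ.2 _ ?_
      rw [Equiv.swap_apply_def]
      split_ifs
      exacts [hi', hi, hl]
  refine Finset.card_equiv (Equiv.mulRight (Equiv.swap i i')) fun π => ⟨key hi hi' π, fun h => ?_⟩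
  have := key hi' hi _ h
  rwa [Equiv.coe_mulRight, mul_assoc, Equiv.swap_comm i' i, Equiv.swap_mul_self, mul_one] at this

theorem disjoint_recordEvent {f : Fin n → α} (hf : Function.Injective f) {b j i j' i' : Fin n}
    (hi : i < j) (hi' : i' < j') (h : ¬ (j = j' ∧ i = i')) :
    Disjoint (recordEvent f b j i) (recordEvent f b j' i') := by
  rw [Finset.disjoint_left]
  intro π h1 h2
  rw [mem_recordEvent] at h1 h2
  have hj : j = j' := π.injective (h1.1.trans h2.1.symm)
  subst hj
  exact h ⟨rfl, π.injective (hf (le_antisymm (h2.2 i hi) (h1.2 i' hi')))⟩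

/-- Agent `b` is in position `j` with probability `1/n`, and her best predecessor is equally likely
to be in each of the `j` earlier positions (positions count from zero). -/
theorem card_recordEvent {f : Fin n → α} (hf : Function.Injective f) {b j i : Fin n}
    (hi : i < j) : n * (j.val * (recordEvent f b j i).card) = n.factorial := by
  classical
  rw [← card_filter_apply_eq b j]
  congr 1
  have h1 : (Finset.univ.filter fun π : Equiv.Perm (Fin n) => π j = b) =
      (Finset.Iio j).biUnion fun i' => recordEvent f b j i' := by
    ext π
    simp only [Finset.mem_filter, Finset.mem_univ, true_and, Finset.mem_biUnion, Finset.mem_Iio,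
      mem_recordEvent]
    constructor
    · intro h
      obtain ⟨i', hi', hmax⟩ := Finset.exists_max_image (Finset.Iio j) (fun l => f (π l))
        ⟨i, Finset.mem_Iio.2 hi⟩
      exact ⟨i', Finset.mem_Iio.1 hi', h, fun l hl => hmax l (Finset.mem_Iio.2 hl)⟩
    · rintro ⟨_, _, h, _⟩
      exact h
  rw [h1, Finset.card_biUnion fun i₁ h₁ i₂ h₂ hne => disjoint_recordEvent hf
      (Finset.mem_Iio.1 h₁) (Finset.mem_Iio.1 h₂) fun h => hne h.2,
    Finset.sum_congr rfl fun i' hi' => card_recordEvent_eq f b (Finset.mem_Iio.1 hi') hi,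
    Finset.sum_const, Fin.card_Iio, smul_eq_mul]

/-- A set of arrival orders, of known size, in which agent `b` comes after the first `r` agents and
the best of her predecessors is among the first `r` agents. -/
theorem exists_card_eq_secretary {f : Fin n → α} (hf : Function.Injective f) (b : Fin n) {r : ℕ}
    (hr : r ≤ n) :
    ∃ G : Finset (Equiv.Perm (Fin n)),
      (∀ π ∈ G, ∃ j i : Fin n, i.val < r ∧ r ≤ j.val ∧ π ∈ recordEvent f b j i) ∧
      (G.card : ℝ) = n.factorial * ((r / n : ℝ) * ∑ j ∈ Finset.Ico r n, (1 / j : ℝ)) := by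
  classical
  let I : Finset (Fin n × Fin n) :=
    (Finset.univ.filter fun j : Fin n => r ≤ j.val) ×ˢ (Finset.univ.filter fun i => i.val < r)
  have hI : ∀ x ∈ I, r ≤ x.1.val ∧ x.2.val < r := by
    intro x hx
    simpa [I] using hx
  refine ⟨I.biUnion fun x => recordEvent f b x.1 x.2, fun π hπ => ?_, ?_⟩
  · obtain ⟨x, hx, hπ⟩ := Finset.mem_biUnion.1 hπ
    exact ⟨x.1, x.2, (hI x hx).2, (hI x hx).1, hπ⟩
  · have hlt : ∀ x ∈ I, x.2 < x.1 := fun x hx => Fin.lt_def.2 ((hI x hx).2.trans_le (hI x hx).1)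
    rw [Finset.card_biUnion fun x hx y hy hne => disjoint_recordEvent hf (hlt x hx) (hlt y hy)
      fun h => hne (Prod.ext h.1 h.2)]
    have hcard : ∀ x ∈ I, ((recordEvent f b x.1 x.2).card : ℝ) =
        n.factorial / n * (1 / x.1.val) := by
      intro x hx
      have h1 := card_recordEvent hf (b := b) (hlt x hx)
      have hn : (n : ℝ) ≠ 0 := by
        have := x.1.isLt
        exact_mod_cast (by omega : n ≠ 0)
      have hj : ((x.1 : ℕ) : ℝ) ≠ 0 := by
        have := Fin.lt_def.1 (hlt x hx)
        exact_mod_cast (by omega : (x.1 : ℕ) ≠ 0)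
      rw [← h1]
      push_cast
      field_simp
    have hsum : ∑ j ∈ Finset.univ.filter (fun j : Fin n => r ≤ j.val), (1 / (j.val : ℝ)) =
        ∑ j ∈ Finset.Ico r n, (1 / j : ℝ) := by
      rw [Finset.sum_filter, Fin.sum_univ_eq_sum_range (fun j => if r ≤ j then (1 / j : ℝ) else 0),
        ← Finset.sum_filter]
      congr 1
      ext j
      simp [and_comm]
    rw [Nat.cast_sum, Finset.sum_congr rfl hcard, Finset.sum_product]
    simp only [Finset.sum_const, Fin.card_filter_val_lt, min_eq_right hr, nsmul_eq_mul]
    rw [← Finset.mul_sum, ← Finset.mul_sum, hsum]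
    ring

end Secretary

/-! ### The constant `1/e` for every `n`, despite the rounding in `⌊n/e⌋`. -/

section SecretaryConstant

/-- The trapezoidal estimate for `1/x`, obtained from `y ≤ sinh y` at `y = log ((j + 1) / j)`. -/
theorem log_succ_sub_log_le {j : ℕ} (hj : 0 < j) :
    Real.log ((j + 1 : ℕ) : ℝ) - Real.log j ≤ 1 / 2 * (1 / j + 1 / ((j + 1 : ℕ) : ℝ)) := by
  have hj' : (0 : ℝ) < j := by exact_mod_cast hj
  have hj1 : (0 : ℝ) < ((j + 1 : ℕ) : ℝ) := by positivity
  rw [← Real.log_div hj1.ne' hj'.ne']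
  have hpos : 0 < ((j + 1 : ℕ) : ℝ) / j := div_pos hj1 hj'
  have h1 : 0 ≤ Real.log (((j + 1 : ℕ) : ℝ) / j) := by
    refine Real.log_nonneg ((one_le_div hj').2 ?_)
    push_cast
    linarith
  refine (Real.self_le_sinh_iff.2 h1).trans (le_of_eq ?_)
  rw [Real.sinh_log hpos, inv_div]
  push_cast
  field_simp
  ring

/-- The trapezoid's correction term `(1/r - 1/m) / 2` is what later pays for rounding `n/e` down. -/
theorem log_sub_log_add_le_sum {r m : ℕ} (hr : 0 < r) (hm : r ≤ m) :
    Real.log m - Real.log r + 1 / 2 * (1 / r - 1 / m) ≤ ∑ j ∈ Finset.Ico r m, (1 / j : ℝ) := by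
  induction m, hm using Nat.le_induction with
  | base => simp
  | succ m hm ih =>
    rw [Finset.sum_Ico_succ_top hm]
    have := log_succ_sub_log_le (hr.trans_le hm)
    linarith

theorem exp_one_bounds : (2.718 : ℝ) < Real.exp 1 ∧ Real.exp 1 < 2.719 :=
  ⟨by linarith [Real.exp_one_gt_d9], by linarith [Real.exp_one_lt_d9]⟩

/-- With an observation phase of `⌊n/e⌋` agents the best agent is hired with probability at
least `1/e`. -/
theorem inv_exp_le_secretary {n : ℕ} (hr : 0 < ⌊(n : ℝ) / Real.exp 1⌋₊) :
    1 / Real.exp 1 ≤ ((⌊(n : ℝ) / Real.exp 1⌋₊ : ℝ) / n) *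
      ∑ j ∈ Finset.Ico ⌊(n : ℝ) / Real.exp 1⌋₊ n, (1 / j : ℝ) := by
  obtain ⟨he1, he2⟩ := exp_one_bounds
  have he0 := Real.exp_pos 1
  set r := ⌊(n : ℝ) / Real.exp 1⌋₊ with hrdef
  have hfl : (r : ℝ) ≤ n / Real.exp 1 := Nat.floor_le (by positivity)
  have hlt : (n : ℝ) / Real.exp 1 < r + 1 := Nat.lt_floor_add_one _
  have hr1 : (1 : ℝ) ≤ r := by exact_mod_cast hr
  have hrn : r * Real.exp 1 ≤ n := (le_div_iff₀ he0).1 hfl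
  have hnr : (n : ℝ) < (r + 1) * Real.exp 1 := (div_lt_iff₀ he0).1 hlt
  have hn0 : (0 : ℝ) < n := by nlinarith
  have hrnn : r ≤ n := by
    have : (r : ℝ) ≤ n := by nlinarith
    exact_mod_cast this
  set θ := (n : ℝ) / Real.exp 1 - r with hθ
  have hθ0 : 0 ≤ θ := by linarith
  have hθ1 : θ < 1 := by linarith
  have hlog : 1 + 2 * θ / (2 * r + θ) ≤ Real.log n - Real.log r := by
    have h1 := Real.le_log_one_add_of_nonneg (x := θ / r) (by positivity)
    have h2 : 1 + θ / r = n / Real.exp 1 / r := by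
      rw [hθ]
      field_simp
      ring
    rw [h2, Real.log_div (by positivity) (by positivity), Real.log_div hn0.ne' he0.ne',
      Real.log_exp] at h1
    have h3 : 2 * (θ / r) / (θ / r + 2) = 2 * θ / (2 * r + θ) := by
      field_simp
      ring
    linarith
  -- This is the rounding loss; the gain is `(1 - r/n) / 2 ≥ (1 - 0.37) / 2 = 0.315`. For `r ≥ 2`,
  -- `θ < 1` suffices. For `r = 1` it would only give `1/3`, but there `n ≤ 5`, so `θ ≤ 5/e - 1 <
  -- 0.85`.
  have hkey : θ ^ 2 / (2 * r + θ) ≤ 0.315 := by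
    rw [div_le_iff₀ (by positivity)]
    rcases (Nat.succ_le_of_lt hr).eq_or_lt with h | h
    · have hr' : (r : ℝ) = 1 := by exact_mod_cast h.symm
      have hn5 : n ≤ 5 := by
        have : (n : ℝ) < 6 := by
          rw [hr'] at hnr
          linarith
        exact Nat.lt_succ_iff.1 (by exact_mod_cast this)
      have hn5' : (n : ℝ) ≤ 5 := by exact_mod_cast hn5
      have hθ2 : θ ≤ 0.85 := by
        rw [hθ, hr', sub_le_iff_le_add, div_le_iff₀ he0]
        linarith
      rw [hr']
      nlinarith
    · have hr' : (2 : ℝ) ≤ r := by exact_mod_cast h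
      nlinarith
  have hratio : (r : ℝ) / n ≤ 0.37 := by
    rw [div_le_iff₀ hn0]
    nlinarith
  have hsum := log_sub_log_add_le_sum hr hrnn
  have hmain : (n : ℝ) / Real.exp 1 ≤ r * ∑ j ∈ Finset.Ico r n, (1 / j : ℝ) := by
    have h1 : r * (1 + 2 * θ / (2 * r + θ) + 1 / 2 * (1 / r - 1 / n)) =
        r + θ - θ ^ 2 / (2 * r + θ) + 1 / 2 * (1 - r / n) := by
      field_simp
      ring
    have h2 : r * (1 + 2 * θ / (2 * r + θ) + 1 / 2 * (1 / r - 1 / n)) ≤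
        r * ∑ j ∈ Finset.Ico r n, (1 / j : ℝ) :=
      mul_le_mul_of_nonneg_left (by linarith) (by linarith)
    have h3 : (n : ℝ) / Real.exp 1 = r + θ := by rw [hθ]; ring
    rw [h3]
    linarith
  rw [div_mul_eq_mul_div, le_div_iff₀ hn0, one_div_mul_eq_div]
  exact hmain

end SecretaryConstant

/-! ### Dynkin's algorithm. -/

section Dynkin

variable {B : ℝ} {tie : Equiv.Perm (Fin n)}

theorem score_injective : Function.Injective (score v tie) := fun _ _ h =>
  tie.injective (congrArg (fun x : Lex (ℝ × Fin n) => (ofLex x).2) h)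

theorem value_le_of_score_le {i j : Fin n} (h : score v tie i ≤ score v tie j) :
    v {i} ≤ v {j} := by
  rcases Prod.Lex.toLex_le_toLex.1 h with h | h
  · exact h.le
  · exact h.1.le

/-- Nobody between the observation phase and `b` can qualify, each being beaten by an observed agent
and hence by the best of them. -/
theorem dynkin_winners_eq {b j : Fin n} (hb : ∀ i, score v tie i ≤ score v tie b)
    {π : Equiv.Perm (Fin n)} (hj : ⌊(n : ℝ) / Real.exp 1⌋₊ ≤ j.val) (hπ : π j = b)
    (h : ∀ l < j, ⌊(n : ℝ) / Real.exp 1⌋₊ ≤ l.val →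
      ∃ i : Fin n, i.val < ⌊(n : ℝ) / Real.exp 1⌋₊ ∧ score v tie (π l) < score v tie (π i)) :
    (dynkin v B tie π).winners = {b} := by
  classical
  set r := ⌊(n : ℝ) / Real.exp 1⌋₊ with hr
  have hfind : ((arrivals π).drop r).find? (fun x => decide
      (∀ i ∈ ((arrivals π).take r).argmax (score v tie), score v tie i ≤ score v tie x)) =
      some b := by
    rw [List.find?_eq_some_iff_getElem]
    refine ⟨by simpa using fun i _ => hb i, j.val - r, ?_, ?_, fun l hl => ?_⟩
    · simp only [arrivals, List.length_drop, List.length_ofFn]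
      omega
    · simp only [arrivals, List.getElem_drop, List.getElem_ofFn]
      rw [← hπ]
      congr 1
      ext
      simp
      omega
    · simp only [arrivals, List.getElem_drop, List.getElem_ofFn, Bool.not_eq_true',
        decide_eq_false_iff_not]
      intro hcon
      have hln : r + l < n := by omega
      obtain ⟨i, hi, hlt⟩ := h ⟨r + l, hln⟩ (Fin.lt_def.2 (by simp; omega)) (by simp)
      have hmem : π i ∈ (List.ofFn π).take r := by
        rw [List.mem_take_iff_getElem]
        exact ⟨i.val, by simp [hi], by simp⟩
      cases harg : ((List.ofFn π).take r).argmax (score v tie) with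
      | none =>
        rw [List.argmax_eq_none.1 harg] at hmem
        exact absurd hmem List.not_mem_nil
      | some m =>
        have h1 := List.le_of_mem_argmax hmem harg
        exact absurd (hcon m harg) (not_le.2 (hlt.trans_le h1))
  unfold dynkin
  dsimp only
  rw [← hr]
  split
  · next x hx =>
    have : some x = some b := hx.symm.trans (by convert hfind)
    rw [Option.some.inj this]
  · next hx =>
    have : none = some b := hx.symm.trans (by convert hfind)
    exact absurd this (Option.some_ne_none b).symm

/-- Dynkin's algorithm hires the best agent with probability at least `1/e`. -/
theorem inv_exp_mul_le_expect_dynkin (hv0 : v ∅ = 0) (hvmono : Monotone v) (i₀ : Fin n) :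
    1 / Real.exp 1 * v {i₀} ≤ 𝔼 π : Equiv.Perm (Fin n), v (dynkin v B tie π).winners := by
  classical
  obtain ⟨b, -, hb⟩ := Finset.exists_max_image Finset.univ (score v tie) ⟨i₀, Finset.mem_univ _⟩
  replace hb : ∀ i, score v tie i ≤ score v tie b := fun i => hb i (Finset.mem_univ i)
  have hn : 0 < n := i₀.pos
  have hnR : (0 : ℝ) < n := by exact_mod_cast hn
  have hvb0 := nonneg_of_monotone hv0 hvmono {b}
  suffices h : ∃ G : Finset (Equiv.Perm (Fin n)),
      (∀ π ∈ G, (dynkin v B tie π).winners = {b}) ∧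
      (n.factorial : ℝ) * (1 / Real.exp 1) ≤ G.card by
    obtain ⟨G, hG, hcard⟩ := h
    rw [Fintype.expect_eq_sum_div_card, Fintype.card_perm, Fintype.card_fin,
      le_div_iff₀ (by positivity)]
    calc 1 / Real.exp 1 * v {i₀} * n.factorial
        ≤ 1 / Real.exp 1 * v {b} * n.factorial := by
          gcongr
          exact value_le_of_score_le (hb i₀)
      _ = (n.factorial : ℝ) * (1 / Real.exp 1) * v {b} := by ring
      _ ≤ G.card * v {b} := mul_le_mul_of_nonneg_right hcard hvb0
      _ = ∑ π ∈ G, v (dynkin v B tie π).winners := by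
          rw [Finset.sum_congr rfl fun π hπ => by rw [hG π hπ], Finset.sum_const, nsmul_eq_mul]
      _ ≤ ∑ π, v (dynkin v B tie π).winners :=
          Finset.sum_le_sum_of_subset_of_nonneg (Finset.subset_univ G)
            fun π _ _ => nonneg_of_monotone hv0 hvmono _
  rcases Nat.eq_zero_or_pos ⌊(n : ℝ) / Real.exp 1⌋₊ with hr | hr
  -- Nobody is observed, so the first agent is hired; she is the best with probability `1/n`, and
  -- here `n < e`.
  · refine ⟨Finset.univ.filter fun π => π ⟨0, hn⟩ = b, fun π hπ => ?_, ?_⟩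
    · exact dynkin_winners_eq hb (by simp [hr]) (Finset.mem_filter.1 hπ).2
        fun l hl => absurd hl (by simp [Fin.lt_def])
    · have h1 := card_filter_apply_eq b ⟨0, hn⟩
      have h2 : (n : ℝ) < Real.exp 1 := by
        have := Nat.floor_eq_zero.1 hr
        rwa [div_lt_one (Real.exp_pos 1)] at this
      rw [← h1, Nat.cast_mul, mul_one_div, div_le_iff₀ (Real.exp_pos 1), mul_comm]
      exact mul_le_mul_of_nonneg_left h2.le (Nat.cast_nonneg _)
  · have hrn : ⌊(n : ℝ) / Real.exp 1⌋₊ ≤ n :=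
      Nat.floor_le_of_le (div_le_self hnR.le (Real.one_le_exp zero_le_one))
    obtain ⟨G, hG, hcard⟩ := exists_card_eq_secretary (score_injective (v := v) (tie := tie)) b hrn
    refine ⟨G, fun π hπ => ?_, ?_⟩
    · obtain ⟨j, i, hi, hj, hmem⟩ := hG π hπ
      rw [mem_recordEvent] at hmem
      refine dynkin_winners_eq hb hj hmem.1 fun l hl hlr => ⟨i, hi, ?_⟩
      -- Scores are injective, so a tie would force `l = i`, yet `i < r ≤ l`.
      refine (hmem.2 l hl).lt_of_ne fun heq => ?_
      have := π.injective (score_injective heq)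
      omega
    · rw [hcard]
      exact mul_le_mul_of_nonneg_left (inv_exp_le_secretary hr) (Nat.cast_nonneg _)

end Dynkin

/-! ### The posted-price branch in expectation. -/

/-- The posted-price part is good whenever the sample has about the expected share of the
value of the optimal solution. -/
theorem postedPrice_lower_bound (hv0 : v ∅ = 0) (hvmono : Monotone v) (hvsub : IsSubmodular v)
    {B : ℝ} (hB : 0 < B) {c : Fin n → ℝ} (hc : ∀ i, 0 < c i) {U : Finset (Fin n)}
    (hU : IsOptimal v c B U) (hUpos : 0 < v U) {ε p δ a β z A : ℝ} (hβ : 0 ≤ β)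
    (hA : A = a * (1 - ε) + β * ((Real.exp 1 - 1) / Real.exp 1) * (p - δ)) (hA0 : 0 < A)
    (hsmall : ∀ i, v {i} ≤ 1 / z * A * v U) (hz : 0 < z)
    {T : Finset (Fin n) → Finset (Fin n)} (hT : IsOfflineApprox v c B T)
    {w : Fin n → ℝ} (hwU : ∑ i, w i = v U) (hw : ∀ R : Finset (Fin n), ∑ i ∈ R, w i ≤ v (U ∩ R))
    (π : Equiv.Perm (Fin n)) (ξ : ℕ)
    (hlow : (p - δ) * v U ≤ ∑ i ∈ ((arrivals π).take ξ).toFinset, w i)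
    (hupp : ∑ i ∈ ((arrivals π).take ξ).toFinset, w i ≤ (p + δ) * v U) :
    min (1 - p - δ - (a * (1 - ε) + β)) ((z - 1) / z * A) * v U ≤
      v (postedPrice v c B a β ((1 - ε) * v U) T π ξ).winners := by
  unfold postedPrice
  dsimp only
  set N := ((arrivals π).take ξ).toFinset with hN
  set t := a * ((1 - ε) * v U) + β * v (T N) with ht
  obtain ⟨hTN, hTfeas, hTapp⟩ := hT N
  have hfeas : ∀ R : Finset (Fin n), IsFeasible c B (U ∩ R) := fun R =>
    (Finset.sum_le_sum_of_subset_of_nonneg Finset.inter_subset_left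
      fun i _ _ => (hc i).le).trans hU.1
  have he : 0 ≤ (Real.exp 1 - 1) / Real.exp 1 :=
    div_nonneg (by linarith [Real.one_le_exp zero_le_one]) (Real.exp_pos 1).le
  have he' : (1 - 1 / Real.exp 1) = (Real.exp 1 - 1) / Real.exp 1 := by
    field_simp
  -- `U ∩ N` is feasible within the sample, so the offline solution competes with it.
  have hTlow : (Real.exp 1 - 1) / Real.exp 1 * ((p - δ) * v U) ≤ v (T N) :=
    (mul_le_mul_of_nonneg_left (hlow.trans (hw N)) he).trans
      (he' ▸ hTapp _ Finset.inter_subset_right (hfeas N))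
  have htlow : A * v U ≤ t := by
    have := mul_le_mul_of_nonneg_left hTlow hβ
    rw [ht, hA]
    linarith
  have htupp : t ≤ (a * (1 - ε) + β) * v U := by
    have := mul_le_mul_of_nonneg_left (hU.2 _ hTfeas) hβ
    rw [ht]
    linarith
  have ht0 : 0 < t := (mul_pos hA0 hUpos).trans_le htlow
  have hcompl : (1 - p - δ) * v U ≤ v (U ∩ Nᶜ) := by
    have h1 := hw Nᶜ
    have h2 := Finset.sum_add_sum_compl N w
    linarith
  have hmem : ∀ i ∈ U ∩ Nᶜ, i ∈ (arrivals π).drop ξ := by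
    intro i hi
    have h1 : i ∉ N := Finset.mem_compl.1 (Finset.mem_inter.1 hi).2
    have h2 : i ∈ arrivals π := by
      simp only [arrivals, List.mem_ofFn]
      exact π.surjective i
    rw [← List.take_append_drop ξ (arrivals π), List.mem_append] at h2
    exact h2.resolve_left fun h => h1 (List.mem_toFinset.2 h)
  -- The benchmark is the unsampled part `U ∩ Nᶜ`, all of which is offered a price; singleton values
  -- are at most `A * v U / z`.
  refine le_trans ?_ (foldl_posted_lower_bound hv0 hvmono hvsub hB ht0 hc hsmall
    (hfeas Nᶜ) _ hmem rfl rfl)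
  refine le_min ?_ ?_
  · refine (mul_le_mul_of_nonneg_right (min_le_left _ _) hUpos.le).trans ?_
    linarith
  · refine (mul_le_mul_of_nonneg_right (min_le_right _ _) hUpos.le).trans ?_
    have : (z - 1) / z * A * v U = A * v U - 1 / z * A * v U := by
      field_simp
    linarith

theorem le_expect_postedPrice (hv0 : v ∅ = 0) (hvmono : Monotone v) (hvsub : IsSubmodular v)
    {B : ℝ} (hB : 0 < B) {c : Fin n → ℝ} (hc : ∀ i, 0 < c i) {U : Finset (Fin n)}
    (hU : IsOptimal v c B U) (hUpos : 0 < v U) {ε k δ a β z : ℝ} (hk : 1 ≤ k) (hβ : 0 ≤ β)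
    (hδ : 0 < δ) (hz : 0 < z) (hA0 : 0 < thresholdFactor k a β δ ε)
    (hsmall : ∀ i, v {i} ≤ 1 / z * thresholdFactor k a β δ ε * v U)
    (hm : 0 ≤ caseBound k z a β δ ε)
    {T : Finset (Fin n) → Finset (Fin n)} (hT : IsOfflineApprox v c B T) :
    pTilde k z a β δ ε * caseBound k z a β δ ε * v U ≤
      ∑ ξ ∈ Finset.range (n + 1), ((n.choose ξ : ℝ) * (1 / k) ^ ξ * (1 - 1 / k) ^ (n - ξ)) *
        (𝔼 π : Equiv.Perm (Fin n),
          v (postedPrice v c B a β ((1 - ε) * v U) T π ξ).winners) := by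
  classical
  have hk0 : 0 < k := by linarith
  have hp0 : 0 ≤ 1 / k := by positivity
  have hp1 : 1 / k ≤ 1 := (div_le_one hk0).2 hk
  obtain ⟨w, hw, -, hwU, hwR⟩ := exists_additive_minorant hv0 hvmono hvsub U
  let good : Finset (Fin n) → Prop := fun S =>
    (1 / k - δ) * v U ≤ ∑ i ∈ S, w i ∧ ∑ i ∈ S, w i ≤ (1 / k + δ) * v U
  have hcase : caseBound k z a β δ ε = min (1 - 1 / k - δ - (a * (1 - ε) + β))
      ((z - 1) / z * thresholdFactor k a β δ ε) := by
    rw [caseBound, sub_div, div_self hk0.ne']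
  have htail := one_sub_two_mul_exp_le_sum_bernoulliWeight (n := n) hp0 hp1
    (mul_pos (one_div_pos.2 hz) hA0) hUpos hδ w (fun i => (hw i).1)
    (fun i => (hw i).2.trans (hsmall i)) hwU
  have hpt : pTilde k z a β δ ε ≤ ∑ S : Finset (Fin n) with good S, bernoulliWeight (1 / k) S := by
    refine le_trans (le_of_eq ?_) htail
    rw [pTilde]
    -- The term `(k - 1) / k ^ 2` is the variance of one Bernoulli trial with parameter `1 / k`.
    have : (k - 1) / k ^ 2 = 1 / k * (1 - 1 / k) := by
      field_simp
    rw [this, mul_assoc (1 / k * (1 - 1 / k) + δ / 3)]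
  calc pTilde k z a β δ ε * caseBound k z a β δ ε * v U
      = pTilde k z a β δ ε * (caseBound k z a β δ ε * v U) := by ring
    _ ≤ (∑ S : Finset (Fin n) with good S, bernoulliWeight (1 / k) S) *
          (caseBound k z a β δ ε * v U) :=
        -- Replacing the probability of a good sample by `p̃` needs a nonnegative case bound; bad
        -- samples count as `0`.
        mul_le_mul_of_nonneg_right hpt (mul_nonneg hm hUpos.le)
    _ = ∑ S : Finset (Fin n), (1 / k) ^ S.card * (1 - 1 / k) ^ (n - S.card) *
          (if good S then caseBound k z a β δ ε * v U else 0) := by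
        rw [Finset.sum_mul, Finset.sum_filter]
        refine Finset.sum_congr rfl fun S _ => ?_
        rw [mul_ite, mul_zero]
        rfl
    _ = _ := (sum_binomial_expect_take _ _).symm
    _ ≤ _ := by
        refine Finset.sum_le_sum fun ξ _ => mul_le_mul_of_nonneg_left ?_ ?_
        · refine Finset.expect_le_expect fun π _ => ?_
          split_ifs with hg
          · rw [hcase]
            exact postedPrice_lower_bound hv0 hvmono hvsub hB hc hU hUpos hβ rfl hA0 hsmall hz
              hT hwU hwR π ξ hg.1 hg.2
          · exact nonneg_of_monotone hv0 hvmono _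
        · exact mul_nonneg (mul_nonneg (Nat.cast_nonneg _) (pow_nonneg hp0 _))
            (pow_nonneg (sub_nonneg.2 hp1) _)

end BudgetFeasible

theorem mainTheorem4 {n : ℕ}
    (v : Finset (Fin n) → ℝ) (hv0 : v ∅ = 0) (hvmono : Monotone v)
    (hvsub : BudgetFeasible.IsSubmodular v)
    (B : ℝ) (hB : 0 < B)
    (c : Fin n → ℝ) (hc : ∀ i, 0 < c i ∧ c i ≤ B)
    (Sstar : Finset (Fin n)) (hSstar : BudgetFeasible.IsOptimal v c B Sstar)
    (ε : ℝ) (hε : 0 ≤ ε ∧ ε < 1) (ω : ℝ) (hω : ω = (1 - ε) * v Sstar)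
    (q : ℝ) (hq : 0 ≤ q ∧ q ≤ 1) (k : ℝ) (hk : 1 ≤ k)
    (a β z δ : ℝ) (ha : 0 ≤ a) (hβ : 0 ≤ β) (hz : 0 < z) (hδ : 0 < δ)
    (hsign : 0 ≤ BudgetFeasible.pTilde k z a β δ ε ∨
      0 ≤ BudgetFeasible.caseBound k z a β δ ε)
    (T : Finset (Fin n) → Finset (Fin n)) (hT : BudgetFeasible.IsOfflineApprox v c B T)
    (tie : Equiv.Perm (Fin n)) :
    BudgetFeasible.guarantee q k z a β δ ε * v Sstar ≤
      BudgetFeasible.expectedValue v c B q k a β ω T tie := by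
  have hexp_nonneg : ∀ f : Equiv.Perm (Fin n) → Finset (Fin n), 0 ≤ 𝔼 π, v (f π) := fun f =>
    Finset.expect_nonneg fun π _ => BudgetFeasible.nonneg_of_monotone hv0 hvmono (f π)
  have hk0 : 0 < k := by linarith
  have hq1 : 0 ≤ 1 - q := sub_nonneg.2 hq.2
  have hweight : ∀ ξ, 0 ≤ (n.choose ξ : ℝ) * (1 / k) ^ ξ * (1 - 1 / k) ^ (n - ξ) := fun ξ =>
    mul_nonneg (mul_nonneg (Nat.cast_nonneg _) (pow_nonneg (one_div_pos.2 hk0).le _))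
      (pow_nonneg (sub_nonneg.2 ((div_le_one hk0).2 hk)) _)
  have hD := mul_nonneg hq.1 (hexp_nonneg fun π => (BudgetFeasible.dynkin v B tie π).winners)
  have hP := mul_nonneg hq1 (Finset.sum_nonneg fun ξ (_ : ξ ∈ Finset.range (n + 1)) =>
    mul_nonneg (hweight ξ)
      (hexp_nonneg fun π => (BudgetFeasible.postedPrice v c B a β ω T π ξ).winners))
  have hV := BudgetFeasible.nonneg_of_monotone hv0 hvmono Sstar
  rw [BudgetFeasible.expectedValue]
  have htriv : BudgetFeasible.guarantee q k z a β δ ε * v Sstar ≤ 0 →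
      BudgetFeasible.guarantee q k z a β δ ε * v Sstar ≤ _ :=
    fun h => h.trans (add_nonneg hD hP)
  rcases hV.eq_or_lt with hV0 | hVpos
  · exact htriv (by rw [← hV0, mul_zero])
  rcases le_or_gt (BudgetFeasible.thresholdFactor k a β δ ε) 0 with hA | hA
  · refine htriv (mul_nonpos_of_nonpos_of_nonneg ((min_le_left _ _).trans ?_) hV)
    exact mul_nonpos_of_nonneg_of_nonpos
      (div_nonneg hq.1 (mul_pos (Real.exp_pos 1) hz).le) hA
  rcases lt_or_ge (BudgetFeasible.caseBound k z a β δ ε) 0 with hm | hm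
  -- Two negative factors would make a positive, unproved guarantee; `hsign` excludes this, so the
  -- bound is trivial.
  · have hp := hsign.resolve_right (not_le.2 hm)
    refine htriv (mul_nonpos_of_nonpos_of_nonneg ((min_le_right _ _).trans ?_) hV)
    exact mul_nonpos_of_nonneg_of_nonpos (mul_nonneg hq1 hp) hm.le
  -- In each case one branch alone carries the bound, and the other contributes a nonnegative
  -- amount.
  by_cases hbig : ∀ i, v {i} ≤ 1 / z * BudgetFeasible.thresholdFactor k a β δ ε * v Sstar
  · have h := mul_le_mul_of_nonneg_left (BudgetFeasible.le_expect_postedPrice hv0 hvmono hvsub hB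
      (fun i => (hc i).1) hSstar hVpos hk hβ hδ hz hA hbig hm hT) hq1
    rw [← hω] at h
    have h' := mul_le_mul_of_nonneg_right (min_le_right _ _ :
      BudgetFeasible.guarantee q k z a β δ ε ≤ _) hV
    refine h'.trans ?_
    linarith
  · push Not at hbig
    obtain ⟨i, hi⟩ := hbig
    have h := mul_le_mul_of_nonneg_left
      (BudgetFeasible.inv_exp_mul_le_expect_dynkin (B := B) (tie := tie) hv0 hvmono i) hq.1
    have h1 := mul_le_mul_of_nonneg_left hi.le
      (mul_nonneg hq.1 (one_div_pos.2 (Real.exp_pos 1)).le)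
    have h' := mul_le_mul_of_nonneg_right (min_le_left _ _ :
      BudgetFeasible.guarantee q k z a β δ ε ≤ _) hV
    refine h'.trans ?_
    have h2 : q / (Real.exp 1 * z) * BudgetFeasible.thresholdFactor k a β δ ε * v Sstar =
        q * (1 / Real.exp 1) *
          (1 / z * BudgetFeasible.thresholdFactor k a β δ ε * v Sstar) := by
      field_simp
    linarith
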